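/- Let $(a_n)_{n\in\mathbb{Z}}$ be independent, identically distributed real random variables on a probability space $(\Omega,\mathcal F,\mathbb P)$ with common law $P_0$ satisfying $$0<\inf\operatorname{supp}P_0<\sup\operatorname{supp}P_0<\infty .$$ Let $H_\omega$ be the random Jacobi operator on $\ell^2(\mathbb{Z};\mathbb{C})$ given by $$(H_\omega\phi)_n=-a_{n+1}(\omega)\,\phi_{n+1}+\big(a_{n+1}(\omega)+a_n(\omega)\big)\phi_n-a_n(\omega)\,\phi_{n-1},$$ which is almost surely bounded and self-adjoint, and for $q>0$ and $T>0$ let $$M_T^q=\int_0^\infty \frac{dt}{T}\,e^{-t/T}\sum_{n\in\mathbb{Z}}|n|^q\,\big|\langle\delta_n,e^{-itH_\omega}\delta_0\rangle\big|^2 ,$$ where $(\delta_n)_{n\in\mathbb{Z}}$ is the standard basis of $\ell^2(\mathbb{Z};\mathbb{C})$. Then for every $q\ge 11/2$, almost surely, $M_T^q$ is finite for all $T>0$ and $$\liminf_{T\to\infty}\frac{\log M_T^q}{q\log T}\ \ge\ \frac25-\frac{11}{5q}.$$ -/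

import Mathlib

open MeasureTheory ProbabilityTheory Filter
open scoped ENNReal

noncomputable section

/-- The Hilbert space `ℓ²(ℤ; ℂ)`. -/
abbrev EllTwo : Type := lp (fun _ : ℤ => ℂ) 2

/-- The Kronecker delta `δ_n`, as a vector of `ℓ²(ℤ)`. -/
def kdelta (n : ℤ) : EllTwo := lp.single 2 n (1 : ℂ)

/-- The divergence-gradient difference expression
`(H φ)_n = -a_{n+1} φ_{n+1} + (a_{n+1} + a_n) φ_n - a_n φ_{n-1}` on arbitrary sequences. -/
def divGradExpr (a : ℤ → ℝ) (φ : ℤ → ℂ) (n : ℤ) : ℂ :=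
  -(a (n + 1) : ℂ) * φ (n + 1) + ((a (n + 1) : ℂ) + (a n : ℂ)) * φ n - (a n : ℂ) * φ (n - 1)

theorem memlp_shift (φ : EllTwo) (k : ℤ) :
    Memℓp (fun n : ℤ => (φ (n + k) : ℂ)) 2 := by
  have h := lp.memℓp φ
  rw [memℓp_gen_iff (by norm_num)] at h ⊢
  exact (Equiv.addRight k).summable_iff.2 h

/-- The shift `φ ↦ (φ_{n+k})_n` on `ℓ²(ℤ)`; used only to bound the norm of `divGrad`. -/
def shiftVec (k : ℤ) (φ : EllTwo) : EllTwo := ⟨fun n : ℤ => φ (n + k), memlp_shift φ k⟩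

theorem norm_shiftVec (k : ℤ) (φ : EllTwo) : ‖shiftVec k φ‖ = ‖φ‖ := by
  rw [lp.norm_eq_tsum_rpow (by norm_num), lp.norm_eq_tsum_rpow (by norm_num)]
  congr 1
  exact (Equiv.addRight k).tsum_eq (fun n : ℤ => ‖φ n‖ ^ (2 : ℝ≥0∞).toReal)

theorem norm_divGradExpr_le {a : ℤ → ℝ} {C : ℝ} (ha : ∀ n, |a n| ≤ C) (φ : ℤ → ℂ) (n : ℤ) :
    ‖divGradExpr a φ n‖ ≤ C * ‖φ (n + 1)‖ + 2 * C * ‖φ n‖ + C * ‖φ (n + -1)‖ := by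
  have h (m : ℤ) : ‖(a m : ℂ)‖ ≤ C := by simpa using ha m
  unfold divGradExpr
  refine (norm_sub_le _ _).trans (add_le_add ((norm_add_le _ _).trans (add_le_add ?_ ?_)) ?_)
  · rw [norm_mul, norm_neg]
    exact mul_le_mul_of_nonneg_right (h _) (norm_nonneg _)
  · rw [norm_mul]
    refine mul_le_mul_of_nonneg_right ((norm_add_le _ _).trans ?_) (norm_nonneg _)
    linarith [h (n + 1), h n]
  · rw [norm_mul, ← sub_eq_add_neg]
    exact mul_le_mul_of_nonneg_right (h _) (norm_nonneg _)

/-- The sequence of moduli `(|φ_n|)_n` of a vector of `ℓ²(ℤ)`. -/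
def absVec (φ : EllTwo) : lp (fun _ : ℤ => ℝ) 2 :=
  ⟨fun n : ℤ => ‖φ n‖, (lp.memℓp φ).norm⟩

theorem norm_absVec (φ : EllTwo) : ‖absVec φ‖ = ‖φ‖ := by
  rw [lp.norm_eq_tsum_rpow (by norm_num), lp.norm_eq_tsum_rpow (by norm_num)]
  simp [absVec]

theorem memlp_divGradExpr {a : ℤ → ℝ} {C : ℝ} (ha : ∀ n, |a n| ≤ C) (φ : EllTwo) :
    Memℓp (divGradExpr a φ) 2 :=
  Memℓp.mono (lp.memℓp (C • absVec (shiftVec 1 φ) + (2 * C) • absVec φ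
    + C • absVec (shiftVec (-1) φ))) (fun n => norm_divGradExpr_le ha φ n)

/-- The difference expression with bounded coefficients, as a linear map on `ℓ²(ℤ)`. -/
def divGradLin (a : ℤ → ℝ) (ha : ∃ C : ℝ, ∀ n, |a n| ≤ C) : EllTwo →ₗ[ℂ] EllTwo where
  toFun φ := ⟨divGradExpr a φ, memlp_divGradExpr ha.choose_spec φ⟩
  map_add' φ ψ := by
    ext n
    simp only [divGradExpr, lp.coeFn_add, Pi.add_apply]
    ring
  map_smul' c φ := by
    ext n
    simp only [divGradExpr, lp.coeFn_smul, Pi.smul_apply, smul_eq_mul, RingHom.id_apply]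
    ring

theorem divGradLin_bound (a : ℤ → ℝ) (ha : ∃ C : ℝ, ∀ n, |a n| ≤ C) :
    ∃ B : ℝ, ∀ φ : EllTwo, ‖divGradLin a ha φ‖ ≤ B * ‖φ‖ := by
  obtain ⟨C, hC⟩ := id ha
  have hC0 : 0 ≤ C := (abs_nonneg _).trans (hC 0)
  refine ⟨4 * C, fun φ => ?_⟩
  have h1 : ‖divGradLin a ha φ‖ ≤ ‖C • absVec (shiftVec 1 φ) + (2 * C) • absVec φ
      + C • absVec (shiftVec (-1) φ)‖ :=
    lp.norm_mono (by norm_num) fun n =>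
      (norm_divGradExpr_le hC φ n).trans (le_abs_self _)
  refine h1.trans ((norm_add_le _ _).trans ((add_le_add (norm_add_le _ _) le_rfl).trans ?_))
  simp only [norm_smul, norm_absVec, norm_shiftVec, Real.norm_eq_abs, abs_of_nonneg hC0,
    abs_of_nonneg (mul_nonneg zero_le_two hC0)]
  linarith

open Classical in
/-- The divergence-gradient operator `H` on `ℓ²(ℤ)` with coefficient sequence `a`: a bounded
operator whenever `a` is bounded. (For unbounded `a` the value is the dummy `0`.) -/
def divGrad (a : ℤ → ℝ) : EllTwo →L[ℂ] EllTwo :=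
  if ha : ∃ C : ℝ, ∀ n, |a n| ≤ C then
    (divGradLin a ha).mkContinuousOfExistsBound (divGradLin_bound a ha)
  else 0

theorem divGrad_apply {a : ℤ → ℝ} (ha : ∃ C : ℝ, ∀ n, |a n| ≤ C) (φ : EllTwo) (n : ℤ) :
    divGrad a φ n = -(a (n + 1) : ℂ) * φ (n + 1) + ((a (n + 1) : ℂ) + (a n : ℂ)) * φ n
      - (a n : ℂ) * φ (n - 1) := by
  rw [divGrad, dif_pos ha]
  rfl

/-- The unitary group `e^{-itH}` of the bounded operator `H = divGrad a`. -/
def evolution (a : ℤ → ℝ) (t : ℝ) : EllTwo →L[ℂ] EllTwo :=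
  NormedSpace.exp ((-(Complex.I * (t : ℂ))) • divGrad a)

/-- The time-averaged moment
`M_T^q = ∫_0^∞ (dt/T) e^{-t/T} ∑_{n ∈ ℤ} |n|^q |⟨δ_n, e^{-itH} δ_0⟩|²`, as a value in `[0, ∞]`. -/
def timeAvgMoment (a : ℤ → ℝ) (q T : ℝ) : ℝ≥0∞ :=
  ∫⁻ t in Set.Ioi (0 : ℝ), ENNReal.ofReal (T⁻¹ * Real.exp (-t / T)) *
    ∑' n : ℤ, ENNReal.ofReal
      (|(n : ℝ)| ^ q * ‖inner ℂ (kdelta n) (evolution a t (kdelta 0))‖ ^ 2)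

end

/-! On the almost sure event `m ≤ a n ≤ A` with `m > 0`, the argument is deterministic. The averaged
wave `u = ∫ (dt/T) e^{-t/T} e^{-itH} δ₀` solves `u + iTHu = δ₀`. Since `H` is a discrete divergence,
`∑ u = 1`. Pairing the equation with `u` bounds the mass by `‖u 0‖` and the Dirichlet energy by a
multiple of `‖u 0‖ / T`, and a Sobolev inequality turns this into `sup ‖u‖ ≤ C / √T`
(`norm_le_of_resolvent_eq`). A sequence of sum `1` that is this flat cannot concentrate on `|n| ≤ k`
when `k` is much smaller than `√T`, so its `q`-moment is at least of order `k^(q-2)`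
(`moment_lower_bound`). By Jensen the time-averaged moment dominates that of `u`
(`tsum_avgWave_le_timeAvgMoment`). A ballistic upper bound makes all moments finite, which also puts
`u` in `ℓ¹`. Taking `k ≈ T^(2/5)` gives every exponent below `2/5 * (q - 2)`, and this exceeds the
required `2/5 * q - 11/5`. -/

/-! ### Divergence form and summation by parts. -/

theorem divGradExpr_eq_sub (a : ℤ → ℝ) (u : ℤ → ℂ) (n : ℤ) :
    divGradExpr a u n = (a n : ℂ) * (u n - u (n - 1)) - (a (n + 1) : ℂ) * (u (n + 1) - u n) := by
  unfold divGradExpr; ring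

theorem Summable.int_shift {E : Type*} [AddCommGroup E] [TopologicalSpace E] {f : ℤ → E}
    (hf : Summable f) (k : ℤ) : Summable fun n => f (n + k) :=
  (Equiv.addRight k).summable_iff.2 hf

theorem tsum_int_shift {E : Type*} [AddCommGroup E] [TopologicalSpace E] (f : ℤ → E) (k : ℤ) :
    ∑' n, f (n + k) = ∑' n, f n :=
  (Equiv.addRight k).tsum_eq f

theorem Summable.bounded_mul {f g : ℤ → ℂ} {B : ℝ} (hf : Summable f) (hg : ∀ n, ‖g n‖ ≤ B) :
    Summable fun n => g n * f n :=
  Summable.of_norm_bounded (hf.norm.mul_left B) fun n => by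
    rw [norm_mul]; exact mul_le_mul_of_nonneg_right (hg n) (norm_nonneg _)

section Flux

variable {a : ℤ → ℝ} {A : ℝ} {u : ℤ → ℂ}

theorem summable_flux (hA : ∀ n, |a n| ≤ A) (hu : Summable u) :
    Summable fun n => (a n : ℂ) * (u n - u (n - 1)) :=
  (hu.sub (hu.int_shift (-1))).bounded_mul (B := A) fun n => by simpa using hA n

/-- Conservation law: the total flux is subtracted from its own shift. Summability in `ℓ¹` is
essential here. -/
theorem hasSum_divGradExpr (hA : ∀ n, |a n| ≤ A) (hu : Summable u) :
    HasSum (divGradExpr a u) 0 := by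
  have hd := summable_flux hA hu
  have h := hd.hasSum.sub (hd.int_shift 1).hasSum
  rw [tsum_int_shift (fun n => (a n : ℂ) * (u n - u (n - 1))) 1, sub_self] at h
  refine (congrArg (HasSum · _) (funext fun n => ?_)).mpr h
  rw [divGradExpr_eq_sub, add_sub_cancel_right]

theorem Summable.exists_norm_bound (hu : Summable u) : ∃ B, ∀ n, ‖u n‖ ≤ B :=
  ⟨∑' n, ‖u n‖, fun n => hu.norm.le_tsum n fun _ _ => norm_nonneg _⟩

/-- Summation by parts for the Dirichlet form of `divGradExpr a`. -/
theorem hasSum_conj_mul_divGradExpr (hA : ∀ n, |a n| ≤ A) (hu : Summable u) :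
    ∃ D : ℝ, HasSum (fun n => a n * ‖u n - u (n - 1)‖ ^ 2) D ∧
      HasSum (fun n => (starRingEnd ℂ) (u n) * divGradExpr a u n) (D : ℂ) := by
  obtain ⟨B, hB⟩ := hu.exists_norm_bound
  have hd := summable_flux hA hu
  have hX : Summable fun n => (starRingEnd ℂ) (u n) * ((a n : ℂ) * (u n - u (n - 1))) :=
    hd.bounded_mul (B := B) fun n => by simpa using hB n
  have hY : Summable fun n => (starRingEnd ℂ) (u (n - 1)) * ((a n : ℂ) * (u n - u (n - 1))) :=
    hd.bounded_mul (B := B) fun n => by simpa using hB (n - 1)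
  -- Shifting the second series leaves its sum unchanged: unshifted, the difference is the Dirichlet
  -- form; shifted, it is the pairing of `u` with `Hu`.
  have h1 := hX.hasSum.sub hY.hasSum
  have h2 := hX.hasSum.sub (hY.int_shift 1).hasSum
  rw [tsum_int_shift (fun n =>
    (starRingEnd ℂ) (u (n - 1)) * ((a n : ℂ) * (u n - u (n - 1)))) 1] at h2
  have he : ∀ n, (starRingEnd ℂ) (u n) * ((a n : ℂ) * (u n - u (n - 1)))
      - (starRingEnd ℂ) (u (n - 1)) * ((a n : ℂ) * (u n - u (n - 1)))
      = ((a n * ‖u n - u (n - 1)‖ ^ 2 : ℝ) : ℂ) := fun n => by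
    have := Complex.conj_mul' (u n - u (n - 1))
    push_cast
    rw [← this, map_sub]
    ring
  simp only [he] at h1
  have hs : Summable fun n => a n * ‖u n - u (n - 1)‖ ^ 2 := Complex.summable_ofReal.1 h1.summable
  refine ⟨_, hs.hasSum, ?_⟩
  have h3 := (Complex.hasSum_ofReal.2 hs.hasSum).unique h1
  rw [h3]
  refine (congrArg (HasSum · _) (funext fun n => ?_)).mpr h2
  rw [divGradExpr_eq_sub, add_sub_cancel_right]
  ring

end Flux

/-! ### Sobolev inequality and sup bound for the resolvent equation. -/

/-- A one-dimensional Sobolev inequality on `ℤ`. -/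
theorem sq_norm_le_of_hasSum {u : ℤ → ℂ} {D M s : ℝ} (hs : 0 < s)
    (hD : HasSum (fun n => ‖u n - u (n - 1)‖ ^ 2) D) (hM : HasSum (fun n => ‖u n‖ ^ 2) M) (n : ℤ) :
    ‖u n‖ ^ 2 ≤ s * D + s⁻¹ * M := by
  set g : ℤ → ℝ := fun n => s * ‖u n - u (n - 1)‖ ^ 2
    + s⁻¹ * ((‖u n‖ ^ 2 + ‖u (n - 1)‖ ^ 2) / 2) with hg
  have hM' : HasSum (fun n : ℤ => ‖u (n - 1)‖ ^ 2) M :=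
    (Equiv.addRight (-1 : ℤ)).hasSum_iff (f := fun n : ℤ => ‖u n‖ ^ 2) |>.2 hM
  have hgs : HasSum g (s * D + s⁻¹ * M) := by
    have := (hD.mul_left s).add (((hM.add hM').div_const 2).mul_left s⁻¹)
    rwa [show (M + M) / 2 = M by ring] at this
  have hg0 : ∀ k, 0 ≤ g k := fun k => by positivity
  have hstep : ∀ k, ‖u k‖ ^ 2 ≤ ‖u (k - 1)‖ ^ 2 + g k := fun k => by
    have h1 : ‖u k‖ - ‖u (k - 1)‖ ≤ ‖u k - u (k - 1)‖ := norm_sub_norm_le _ _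
    set x := ‖u k‖
    set y := ‖u (k - 1)‖
    set d := ‖u k - u (k - 1)‖
    have hx : 0 ≤ x := norm_nonneg _
    have hy : 0 ≤ y := norm_nonneg _
    have h2 : x ^ 2 - y ^ 2 ≤ d * (x + y) := by nlinarith
    -- Young's inequality with weight `s`, from a completed square.
    have h3 : d * (x + y) ≤ s * d ^ 2 + s⁻¹ * ((x ^ 2 + y ^ 2) / 2) := by
      have h4 : 0 ≤ s⁻¹ * (s * d - (x + y) / 2) ^ 2 := by positivity
      have h5 : s⁻¹ * (s * d - (x + y) / 2) ^ 2
          = s * d ^ 2 - d * (x + y) + s⁻¹ * ((x + y) / 2) ^ 2 := by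
        field_simp; ring
      have h6 : s⁻¹ * ((x + y) / 2) ^ 2 ≤ s⁻¹ * ((x ^ 2 + y ^ 2) / 2) := by
        gcongr; nlinarith [sq_nonneg (x - y)]
      linarith
    show x ^ 2 ≤ y ^ 2 + (s * d ^ 2 + s⁻¹ * ((x ^ 2 + y ^ 2) / 2))
    linarith
  have hN : ∀ N : ℕ, ‖u n‖ ^ 2 ≤ ‖u (n - N)‖ ^ 2 + ∑ k ∈ Finset.range N, g (n - k) := fun N => by
    induction N with
    | zero => simp
    | succ N ih =>
      rw [Finset.sum_range_succ]
      have := hstep (n - N)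
      rw [sub_sub] at this
      push_cast
      linarith
  have hle : ∀ N : ℕ, ‖u n‖ ^ 2 ≤ ‖u (n - N)‖ ^ 2 + (s * D + s⁻¹ * M) := fun N => by
    refine (hN N).trans (add_le_add le_rfl ?_)
    have hinj : Function.Injective fun k : ℕ => n - (k : ℤ) := fun i j h => by
      simpa using h
    have := sum_le_hasSum ((Finset.range N).map ⟨_, hinj⟩) (fun i _ => hg0 i) hgs
    simpa using this
  -- The telescoped bound starts from `-∞`, where `u` vanishes.
  have hlim : Tendsto (fun N : ℕ => ‖u (n - N)‖ ^ 2 + (s * D + s⁻¹ * M)) atTop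
      (nhds (0 + (s * D + s⁻¹ * M))) := by
    refine Tendsto.add_const _ ?_
    refine hM.summable.tendsto_cofinite_zero.comp ?_
    rw [← Nat.cofinite_eq_atTop]
    exact Function.Injective.tendsto_cofinite fun i j h => by simpa using h
  rw [zero_add] at hlim
  exact ge_of_tendsto' hlim hle

section Resolvent

variable {a : ℤ → ℝ} {m A T : ℝ} {u : ℤ → ℂ}

/-- The total sum of a summable solution of `u + iTHu = δ₀` is `1`. -/
theorem tsum_eq_one_of_resolvent_eq (hA : ∀ n, |a n| ≤ A) (hu : Summable u)
    (heq : ∀ n, u n + Complex.I * T * divGradExpr a u n = if n = 0 then 1 else 0) :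
    ∑' n, u n = 1 := by
  have h := hu.hasSum.add ((hasSum_divGradExpr hA hu).mul_left (Complex.I * T))
  simp only [heq, mul_zero, add_zero] at h
  exact h.unique (hasSum_ite_eq 0 1)

/-- The diffusive sup bound for a summable solution of `u + iTHu = δ₀`. -/
theorem norm_le_of_resolvent_eq (hm : 0 < m) (hma : ∀ n, m ≤ a n) (hA : ∀ n, |a n| ≤ A)
    (hT : 0 < T) (hu : Summable u)
    (heq : ∀ n, u n + Complex.I * T * divGradExpr a u n = if n = 0 then 1 else 0) (n : ℤ) :
    ‖u n‖ ≤ (m⁻¹ + 1) / √T := by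
  obtain ⟨D, hD, hDc⟩ := hasSum_conj_mul_divGradExpr hA hu
  obtain ⟨B, hB⟩ := hu.exists_norm_bound
  have hsq : Summable fun n => ‖u n‖ ^ 2 :=
    Summable.of_nonneg_of_le (fun _ => by positivity)
      (fun n => by rw [sq]; exact mul_le_mul_of_nonneg_right (hB n) (norm_nonneg _))
      (hu.norm.mul_left B)
  obtain ⟨M, hM⟩ := hsq
  have hMc : HasSum (fun n => (starRingEnd ℂ) (u n) * u n) (M : ℂ) := by
    have := Complex.hasSum_ofReal.2 hM
    simpa [Complex.conj_mul'] using this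
  -- Pairing with `u`: the real part controls the mass, the imaginary part the energy.
  have hid : (M : ℂ) + Complex.I * T * D = (starRingEnd ℂ) (u 0) := by
    have h := hMc.add (hDc.mul_left (Complex.I * T))
    have h2 : ∀ n, (starRingEnd ℂ) (u n) * u n + Complex.I * T *
        ((starRingEnd ℂ) (u n) * divGradExpr a u n)
        = if n = 0 then (starRingEnd ℂ) (u 0) else 0 := fun n => by
      have h3 := congrArg (fun z => (starRingEnd ℂ) (u n) * z) (heq n)
      rw [mul_left_comm (Complex.I * T), ← mul_add, h3]
      split_ifs with h0 <;> simp [h0]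
    simp only [h2] at h
    exact h.unique (hasSum_ite_eq 0 _)
  have hre : M = (u 0).re := by simpa using congrArg Complex.re hid
  have him : T * D = -(u 0).im := by simpa using congrArg Complex.im hid
  have hM0 : M ≤ ‖u 0‖ := hre ▸ Complex.re_le_norm _
  have hD0 : T * D ≤ ‖u 0‖ := him ▸ (neg_le_abs _).trans (Complex.abs_im_le_norm _)
  have hs : Summable fun n => ‖u n - u (n - 1)‖ ^ 2 := by
    refine Summable.of_nonneg_of_le (fun _ => by positivity) (fun n => ?_)
      (hD.summable.mul_left m⁻¹)
    rw [← mul_assoc, ← div_eq_inv_mul]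
    exact le_mul_of_one_le_left (by positivity) ((one_le_div hm).2 (hma n))
  obtain ⟨D', hD'⟩ := hs
  have hDD : m * D' ≤ D := hasSum_le
    (fun n => mul_le_mul_of_nonneg_right (hma n) (by positivity)) (hD'.mul_left m) hD
  have hrT : 0 < √T := Real.sqrt_pos.2 hT
  have hTT : √T * √T = T := Real.mul_self_sqrt hT.le
  have hD'T : T * D' ≤ m⁻¹ * ‖u 0‖ := by
    rw [← div_eq_inv_mul, le_div_iff₀ hm]; nlinarith
  -- The weight `s = √T` balances energy `O(‖u 0‖ / T)` against mass `O(‖u 0‖)`.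
  have hsob : ∀ n, ‖u n‖ ^ 2 ≤ (m⁻¹ + 1) / √T * ‖u 0‖ := fun n => by
    refine (sq_norm_le_of_hasSum hrT hD' hM n).trans ?_
    have h1 : √T * D' ≤ m⁻¹ * ‖u 0‖ / √T := by
      rwa [le_div_iff₀ hrT, mul_right_comm, hTT]
    have h2 : (√T)⁻¹ * M ≤ (√T)⁻¹ * ‖u 0‖ := by gcongr
    calc _ ≤ m⁻¹ * ‖u 0‖ / √T + (√T)⁻¹ * ‖u 0‖ := add_le_add h1 h2
      _ = _ := by ring
  have hC : 0 < (m⁻¹ + 1) / √T := by positivity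
  -- Bootstrap: the case `n = 0` bounds `‖u 0‖` itself, and then `hsob` bounds every site.
  have h0 : ‖u 0‖ ≤ (m⁻¹ + 1) / √T := by
    by_contra! h
    nlinarith [hsob 0]
  refine abs_le_of_sq_le_sq' ?_ hC.le |>.2
  nlinarith [hsob n]

end Resolvent

/-! ### Spreading of mass. -/

/-- The mass of a bounded sequence of total sum `1` must spread out, which forces a large moment. -/
theorem moment_lower_bound {u : ℤ → ℂ} {c q Z : ℝ} {k : ℕ} (hk : 0 < k) (hq : 2 ≤ q)
    (hu : Summable u) (h1 : ∑' n, u n = 1) (hc : ∀ n, ‖u n‖ ≤ c)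
    (hkc : (2 * k + 1) * c ≤ 1 / 2) (hZ : HasSum (fun n : ℤ => ((n : ℝ) ^ 2)⁻¹) Z)
    (hS : Summable fun n : ℤ => |(n : ℝ)| ^ q * ‖u n‖ ^ 2) :
    (k : ℝ) ^ (q - 2) / (16 * Z) ≤ ∑' n : ℤ, |(n : ℝ)| ^ q * ‖u n‖ ^ 2 := by
  set S := ∑' n : ℤ, |(n : ℝ)| ^ q * ‖u n‖ ^ 2
  have hk' : (0 : ℝ) < k := by exact_mod_cast hk
  have hZ0 : 0 < Z := by
    have := hZ.tsum_eq ▸ hZ.summable.le_tsum 1 (fun i _ => by positivity)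
    simp at this
    linarith
  set κ : ℝ := (k : ℝ) ^ (q - 2)
  have hκ : 0 < κ := Real.rpow_pos_of_pos hk' _
  -- With this `l` the tail term `(l * κ)⁻¹ * Z` is `1/4`, so `1 ≤ 1/2 + l * S + 1/4`. Off the
  -- window, `x ≤ w * x ^ 2 + w⁻¹` with `w = l * κ * n ^ 2`.
  set l : ℝ := 4 * Z / κ with hl
  have hl0 : 0 < l := by positivity
  have hpt : ∀ n : ℤ, ‖u n‖ ≤ (if n ∈ Finset.Icc (-(k : ℤ)) k then c else 0)
      + l * (|(n : ℝ)| ^ q * ‖u n‖ ^ 2) + (l * κ)⁻¹ * ((n : ℝ) ^ 2)⁻¹ := fun n => by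
    split_ifs with hn
    · have : 0 ≤ l * (|(n : ℝ)| ^ q * ‖u n‖ ^ 2) + (l * κ)⁻¹ * ((n : ℝ) ^ 2)⁻¹ := by positivity
      linarith [hc n]
    · have hn' : (k : ℝ) ≤ |(n : ℝ)| := by
        have : (k : ℤ) ≤ |n| := by
          rw [Finset.mem_Icc] at hn; grind
        exact_mod_cast this
      have hn0 : 0 < |(n : ℝ)| := hk'.trans_le hn'
      have h2 : κ * (n : ℝ) ^ 2 ≤ |(n : ℝ)| ^ q := by
        have h3 : |(n : ℝ)| ^ q = |(n : ℝ)| ^ (q - 2) * (n : ℝ) ^ 2 := by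
          rw [← sq_abs (n : ℝ), ← Real.rpow_natCast |(n : ℝ)| 2, ← Real.rpow_add hn0]
          norm_num
        rw [h3]
        gcongr
        exact Real.rpow_le_rpow hk'.le hn' (by linarith)
      have hn2 : 0 < (n : ℝ) ^ 2 := by rw [← sq_abs]; positivity
      set x := ‖u n‖
      set w := l * (κ * (n : ℝ) ^ 2) with hw
      have hw0 : 0 < w := by positivity
      have h4 : x ≤ w * x ^ 2 + w⁻¹ := by
        have : 0 ≤ w⁻¹ * (w * x - 1 / 2) ^ 2 := by positivity
        have h5 : w⁻¹ * (w * x - 1 / 2) ^ 2 = w * x ^ 2 - x + w⁻¹ / 4 := by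
          field_simp; ring
        have : 0 < w⁻¹ := by positivity
        linarith
      have h6 : w * x ^ 2 ≤ l * (|(n : ℝ)| ^ q * x ^ 2) := by
        rw [hw, mul_assoc]; gcongr
      have h7 : w⁻¹ = (l * κ)⁻¹ * ((n : ℝ) ^ 2)⁻¹ := by rw [hw, ← mul_assoc, mul_inv]
      linarith
  have hfin : HasSum (fun n : ℤ => if n ∈ Finset.Icc (-(k : ℤ)) k then c else 0)
      ((2 * k + 1) * c) := by
    have := hasSum_sum_of_ne_finset_zero (f := fun n : ℤ =>
      if n ∈ Finset.Icc (-(k : ℤ)) k then c else 0) (s := Finset.Icc (-(k : ℤ)) k)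
      (L := .unconditional ℤ)
      (fun n hn => if_neg hn)
    convert this using 1
    rw [Finset.sum_congr rfl (fun n hn => if_pos hn), Finset.sum_const, Int.card_Icc, nsmul_eq_mul]
    congr 1
    have : ((k : ℤ) + 1 - -(k : ℤ)).toNat = 2 * k + 1 := by omega
    rw [this]; push_cast; ring
  have hsum := hasSum_le hpt hu.norm.hasSum
    ((hfin.add (hS.hasSum.mul_left l)).add (hZ.mul_left (l * κ)⁻¹))
  have h1' : 1 ≤ ∑' n, ‖u n‖ := by
    have := norm_tsum_le_tsum_norm hu.norm
    rwa [h1, norm_one] at this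
  have hlast : (l * κ)⁻¹ * Z = 1 / 4 := by rw [hl]; field_simp
  have hfinal : 1 / 4 ≤ l * S := by linarith
  have : κ / (16 * Z) * l = 1 / 4 := by rw [hl]; field_simp; norm_num
  nlinarith

/-! ### The operator on `ℓ²(ℤ)` and its unitary group. -/

theorem inner_kdelta_left (n : ℤ) (φ : EllTwo) : inner ℂ (kdelta n) φ = φ n := by
  rw [kdelta, lp.inner_single_left]
  simp

theorem ellTwo_smul_apply (c : ℂ) (φ : EllTwo) (n : ℤ) : (c • φ) n = c * φ n := rfl

theorem ellTwo_add_apply (φ ψ : EllTwo) (n : ℤ) : (φ + ψ) n = φ n + ψ n := rfl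

theorem ellTwo_real_smul (c : ℝ) (φ : EllTwo) : c • φ = (c : ℂ) • φ :=
  RCLike.real_smul_eq_coe_smul (K := ℂ) c φ

theorem kdelta_apply (n k : ℤ) : kdelta n k = if k = n then 1 else 0 := by
  simp [kdelta, lp.single_apply, Pi.single_apply]

theorem norm_kdelta (n : ℤ) : ‖kdelta n‖ = 1 := by
  rw [kdelta, lp.norm_single (by norm_num)]
  simp

theorem norm_apply_le_norm (φ : EllTwo) (n : ℤ) : ‖φ n‖ ≤ ‖φ‖ :=
  lp.norm_apply_le_norm (by norm_num) φ n

theorem summable_conj_mul_shift (φ ψ : EllTwo) (k : ℤ) :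
    Summable fun n => (starRingEnd ℂ) (φ n) * ψ (n + k) := by
  have h := lp.summable_inner (𝕜 := ℂ) φ (shiftVec k ψ)
  simpa [shiftVec, RCLike.inner_apply, mul_comm] using h

theorem divGrad_symm {a : ℤ → ℝ} (ha : ∃ C : ℝ, ∀ n, |a n| ≤ C) (φ ψ : EllTwo) :
    inner ℂ (divGrad a φ) ψ = inner ℂ φ (divGrad a ψ) := by
  obtain ⟨C, hC⟩ := id ha
  have hCc : ∀ n, ‖(a n : ℂ)‖ ≤ C := fun n => by simpa using hC n
  have hU : Summable fun n => (a (n + 1) : ℂ) * ((starRingEnd ℂ) (φ n) * ψ (n + 1)) :=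
    (summable_conj_mul_shift φ ψ 1).bounded_mul fun n => hCc (n + 1)
  have hV : Summable fun n => (a n : ℂ) * ((starRingEnd ℂ) (φ n) * ψ (n + -1)) :=
    (summable_conj_mul_shift φ ψ (-1)).bounded_mul fun n => hCc n
  -- Two null series, each an off-diagonal series minus its shift, realign the hopping terms.
  have h1 := hU.hasSum.sub (hU.int_shift (-1)).hasSum
  have h2 := hV.hasSum.sub (hV.int_shift 1).hasSum
  rw [tsum_int_shift (fun n => (a (n + 1) : ℂ) * ((starRingEnd ℂ) (φ n) * ψ (n + 1))) (-1),
    sub_self] at h1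
  rw [tsum_int_shift (fun n => (a n : ℂ) * ((starRingEnd ℂ) (φ n) * ψ (n + -1))) 1,
    sub_self] at h2
  have h3 := (lp.hasSum_inner (𝕜 := ℂ) φ (divGrad a ψ)).add (h1.add h2)
  rw [add_zero, add_zero] at h3
  refine (lp.hasSum_inner (𝕜 := ℂ) (divGrad a φ) ψ).unique
    ((congrArg (HasSum · _) (funext fun n => ?_)).mpr h3)
  simp only [RCLike.inner_apply, divGrad_apply ha, map_sub, map_add, map_mul, map_neg,
    Complex.conj_ofReal, ← sub_eq_add_neg, sub_add_cancel]
  ring_nf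

theorem isSelfAdjoint_divGrad {a : ℤ → ℝ} (ha : ∃ C : ℝ, ∀ n, |a n| ≤ C) :
    IsSelfAdjoint (divGrad a) :=
  ContinuousLinearMap.isSelfAdjoint_iff_isSymmetric.2 (divGrad_symm ha)

theorem norm_evolution_apply {a : ℤ → ℝ} (ha : ∃ C : ℝ, ∀ n, |a n| ≤ C) (t : ℝ) (φ : EllTwo) :
    ‖evolution a t φ‖ = ‖φ‖ := by
  have hmem : (-(Complex.I * (t : ℂ))) • divGrad a ∈ skewAdjoint (EllTwo →L[ℂ] EllTwo) :=
    (isSelfAdjoint_divGrad ha).smul_mem_skewAdjoint (by simp [skewAdjoint.mem_iff])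
  let +nondep : NormedAlgebra ℚ (EllTwo →L[ℂ] EllTwo) := NormedAlgebra.restrictScalars ℚ ℂ _
  have hu : evolution a t ∈ unitary (EllTwo →L[ℂ] EllTwo) :=
    NormedSpace.exp_mem_unitary_of_mem_skewAdjoint hmem
  exact ContinuousLinearMap.norm_map_of_mem_unitary hu φ

theorem evolution_eq (a : ℤ → ℝ) (t : ℝ) :
    evolution a t = NormedSpace.exp (t • ((-Complex.I) • divGrad a)) := by
  rw [evolution]
  congr 1
  ext1 φ
  simp only [smul_apply, ellTwo_real_smul, smul_smul]
  congr 1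
  ring

theorem hasDerivAt_evolution (a : ℤ → ℝ) (t : ℝ) (φ : EllTwo) :
    HasDerivAt (fun s => evolution a s φ) ((-Complex.I) • divGrad a (evolution a t φ)) t := by
  have h := hasDerivAt_exp_smul_const' (𝕂 := ℝ) ((-Complex.I) • divGrad a) t
  have h2 := (ContinuousLinearMap.apply ℂ EllTwo φ).restrictScalars ℝ
    |>.hasFDerivAt.comp_hasDerivAt t h
  simp only [evolution_eq]
  exact h2

theorem continuous_evolution (a : ℤ → ℝ) (φ : EllTwo) : Continuous fun t => evolution a t φ :=
  continuous_iff_continuousAt.2 fun t => (hasDerivAt_evolution a t φ).continuousAt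

theorem evolution_zero (a : ℤ → ℝ) : evolution a 0 = 1 := by
  simp [evolution]

/-! ### The time-averaged wave as a resolvent. -/

theorem integrableOn_exp_smul_evolution {a : ℤ → ℝ} (ha : ∃ C : ℝ, ∀ n, |a n| ≤ C) {T : ℝ}
    (hT : 0 < T) (φ : EllTwo) :
    IntegrableOn (fun t : ℝ => (T⁻¹ * Real.exp (-t / T)) • evolution a t φ) (Set.Ioi 0) := by
  have hexp : IntegrableOn (fun t : ℝ => Real.exp (-T⁻¹ * t)) (Set.Ioi 0) :=
    integrableOn_exp_mul_Ioi (neg_lt_zero.2 (inv_pos.2 hT)) 0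
  refine Integrable.mono' (hexp.const_mul (T⁻¹ * ‖φ‖)) ?_ (ae_of_all _ fun t => ?_)
  · have := continuous_evolution a φ
    exact Continuous.aestronglyMeasurable (by fun_prop)
  · rw [norm_smul, norm_evolution_apply ha, Real.norm_of_nonneg (by positivity)]
    apply le_of_eq
    rw [show -t / T = -T⁻¹ * t by field_simp]
    ring

/-- The time-averaged wave `∫₀^∞ (dt/T) e^{-t/T} e^{-itH} φ`. -/
noncomputable def avgWave (a : ℤ → ℝ) (T : ℝ) (φ : EllTwo) : EllTwo :=
  ∫ t in Set.Ioi (0 : ℝ), (T⁻¹ * Real.exp (-t / T)) • evolution a t φ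

theorem avgWave_resolvent_eq {a : ℤ → ℝ} (ha : ∃ C : ℝ, ∀ n, |a n| ≤ C) {T : ℝ}
    (hT : 0 < T) (φ : EllTwo) :
    avgWave a T φ + (Complex.I * T) • divGrad a (avgWave a T φ) = φ := by
  have hint := integrableOn_exp_smul_evolution ha hT φ
  -- `-e^{-t/T} e^{-itH} φ` is a primitive of `(1 + iTH)` applied to the integrand; its value at `0`
  -- is `-φ`.
  have hderiv : ∀ t ∈ Set.Ici (0 : ℝ),
      HasDerivAt (fun t : ℝ => -(Real.exp (-t / T) • evolution a t φ))
      ((ContinuousLinearMap.id ℂ EllTwo + (Complex.I * T) • divGrad a)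
        ((T⁻¹ * Real.exp (-t / T)) • evolution a t φ)) t := fun t _ => by
    have h1 : HasDerivAt (fun t : ℝ => Real.exp (-t / T)) (Real.exp (-t / T) * (-1 / T)) t :=
      ((hasDerivAt_id t).neg.div_const T).exp
    refine (h1.smul (hasDerivAt_evolution a t φ)).neg.congr_deriv (Eq.symm ?_)
    have hTc : (T : ℂ) ≠ 0 := by exact_mod_cast hT.ne'
    simp only [ellTwo_real_smul, map_smul, add_apply, ContinuousLinearMap.id_apply, smul_apply]
    match_scalars <;> simp <;> field_simp
  have hlim : Tendsto (fun t : ℝ => -(Real.exp (-t / T) • evolution a t φ)) atTop (nhds 0) := by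
    rw [← neg_zero]
    refine Tendsto.neg (tendsto_zero_iff_norm_tendsto_zero.2 ?_)
    simp only [norm_smul, norm_evolution_apply ha, Real.norm_eq_abs, Real.abs_exp]
    rw [← zero_mul ‖φ‖]
    refine Tendsto.mul_const _ (Real.tendsto_exp_atBot.comp ?_)
    exact (tendsto_neg_atTop_atBot).atBot_div_const hT
  have h := integral_Ioi_of_hasDerivAt_of_tendsto' hderiv
    (ContinuousLinearMap.integrable_comp _ hint) hlim
  rw [ContinuousLinearMap.integral_comp_comm _ hint] at h
  simpa [avgWave, evolution_zero] using h

theorem avgWave_resolvent_eq_apply {a : ℤ → ℝ} (ha : ∃ C : ℝ, ∀ n, |a n| ≤ C) {T : ℝ}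
    (hT : 0 < T) (n : ℤ) :
    avgWave a T (kdelta 0) n + Complex.I * T * divGradExpr a (avgWave a T (kdelta 0)) n
      = if n = 0 then 1 else 0 := by
  have h := congrArg (fun φ : EllTwo => φ n) (avgWave_resolvent_eq ha hT (kdelta 0))
  rwa [ellTwo_add_apply, ellTwo_smul_apply, kdelta_apply, divGrad_apply ha] at h

/-! ### Ballistic upper bound and finiteness of moments. -/

/-- One application of `H` sums coefficients of total size at most `4 * A`, and moving one site
costs a factor `e` in the weight `e^{-|n|}`. -/
theorem norm_pow_divGrad_apply_le {a : ℤ → ℝ} {A : ℝ} (hA : ∀ n, |a n| ≤ A) (k : ℕ) (n : ℤ) :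
    ‖((divGrad a) ^ k) (kdelta 0) n‖ ≤ (4 * Real.exp 1 * A) ^ k * Real.exp (-|(n : ℝ)|) := by
  have hA0 : 0 ≤ A := (abs_nonneg _).trans (hA 0)
  induction k generalizing n with
  | zero =>
    simp only [pow_zero, one_mul, one_apply_eq_self, kdelta_apply]
    split_ifs with h
    · simp [h]
    · simp; positivity
  | succ k ih =>
    rw [pow_succ', mul_apply_eq_comp, divGrad_apply ⟨A, hA⟩]
    refine (norm_divGradExpr_le hA (((divGrad a) ^ k) (kdelta 0)) n).trans ?_
    set B := (4 * Real.exp 1 * A) ^ k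
    have hB : 0 ≤ B := by positivity
    have hj : ∀ j : ℤ, |(j : ℝ)| ≤ 1 → ‖((divGrad a) ^ k) (kdelta 0) (n + j)‖
        ≤ B * (Real.exp 1 * Real.exp (-|(n : ℝ)|)) := fun j hj => by
      refine (ih (n + j)).trans (mul_le_mul_of_nonneg_left ?_ hB)
      rw [← Real.exp_add, Real.exp_le_exp]
      have := abs_sub_abs_le_abs_sub (n : ℝ) (-(j : ℝ))
      rw [abs_neg, sub_neg_eq_add] at this
      push_cast
      linarith
    have h0 := hj 0 (by simp)
    rw [add_zero] at h0
    calc _ ≤ A * (B * (Real.exp 1 * Real.exp (-|(n : ℝ)|)))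
          + 2 * A * (B * (Real.exp 1 * Real.exp (-|(n : ℝ)|)))
          + A * (B * (Real.exp 1 * Real.exp (-|(n : ℝ)|))) := by
          gcongr
          · exact hj 1 (by simp)
          · exact hj (-1) (by simp)
      _ = _ := by rw [pow_succ]; ring

/-- A ballistic propagation bound. -/
theorem norm_evolution_kdelta_le {a : ℤ → ℝ} {A : ℝ} (hA : ∀ n, |a n| ≤ A) {t : ℝ} (ht : 0 ≤ t)
    (n : ℤ) : ‖evolution a t (kdelta 0) n‖ ≤ Real.exp (4 * Real.exp 1 * A * t - |(n : ℝ)|) := by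
  set z := -(Complex.I * (t : ℂ)) with hz
  have hzn : ‖z‖ = t := by simp [hz, abs_of_nonneg ht]
  have h := NormedSpace.exp_series_hasSum_exp' (𝕂 := ℂ) (z • divGrad a)
  let L : (EllTwo →L[ℂ] EllTwo) →L[ℂ] ℂ :=
    (innerSL ℂ (kdelta n)).comp (ContinuousLinearMap.apply ℂ EllTwo (kdelta 0))
  have hL : ∀ B, L B = B (kdelta 0) n := fun B => by simp [L, inner_kdelta_left]
  have h2 := L.hasSum h
  simp only [hL] at h2
  have hR := NormedSpace.exp_series_hasSum_exp' (𝕂 := ℝ) (4 * Real.exp 1 * A * t)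
  rw [← Real.exp_eq_exp_ℝ] at hR
  have hR2 := hR.mul_right (Real.exp (-|(n : ℝ)|))
  rw [← Real.exp_add, ← sub_eq_add_neg] at hR2
  change HasSum _ (evolution a t (kdelta 0) n) at h2
  rw [← h2.tsum_eq]
  refine tsum_of_norm_bounded hR2 fun k => ?_
  have := norm_pow_divGrad_apply_le hA k n
  rw [smul_pow, smul_apply, smul_apply, ellTwo_smul_apply, ellTwo_smul_apply, norm_mul, norm_mul,
    norm_pow, hzn, norm_inv, RCLike.norm_natCast, smul_eq_mul, mul_pow _ t]
  calc _ ≤ (k.factorial : ℝ)⁻¹ * (t ^ k * ((4 * Real.exp 1 * A) ^ k * Real.exp (-|(n : ℝ)|))) := by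
        gcongr
    _ = _ := by ring

theorem summable_int_sq_inv : Summable fun n : ℤ => ((n : ℝ) ^ 2)⁻¹ := by
  simpa using (Real.summable_one_div_int_pow (p := 2)).2 one_lt_two

theorem moment_term_le {a : ℤ → ℝ} {A q : ℝ} (hA : ∀ n, |a n| ≤ A) (hq : 0 < q) {p : ℕ}
    (hp : q ≤ p) {t : ℝ} (ht : 0 ≤ t) (n : ℤ) :
    |(n : ℝ)| ^ q * ‖evolution a t (kdelta 0) n‖ ^ 2 ≤
      ((2 * (4 * Real.exp 1 * A * t)) ^ (p + 2) + (p + 2).factorial) * ((n : ℝ) ^ 2)⁻¹ := by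
  have hA0 : 0 ≤ A := (abs_nonneg _).trans (hA 0)
  rcases eq_or_ne n 0 with rfl | hn
  -- Both sides are `0`, as `0⁻¹ = 0`.
  · simp [Real.zero_rpow hq.ne']
  set c := 4 * Real.exp 1 * A * t
  have hc : 0 ≤ c := by positivity
  have h1 : ‖evolution a t (kdelta 0) n‖ ≤ 1 := by
    refine (norm_apply_le_norm _ _).trans ?_
    rw [norm_evolution_apply ⟨A, hA⟩, norm_kdelta]
  have h2 : ‖evolution a t (kdelta 0) n‖ ≤ Real.exp (c - |(n : ℝ)|) :=
    norm_evolution_kdelta_le hA ht n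
  set x := |(n : ℝ)| with hx
  set y := ‖evolution a t (kdelta 0) n‖
  have hy : 0 ≤ y := norm_nonneg _
  have hx1 : 1 ≤ x := by
    have : 1 ≤ |n| := Int.one_le_abs hn
    rw [hx]
    exact_mod_cast this
  have hxp : x ^ q ≤ x ^ p := by
    rw [← Real.rpow_natCast]
    exact Real.rpow_le_rpow_of_exponent_le hx1 hp
  rw [← sq_abs (n : ℝ), ← div_eq_mul_inv, le_div_iff₀ (by positivity)]
  -- Inside the cone `x ≤ 2 * c` unitarity suffices; outside, `y ^ 2 ≤ e^{-x}` beats any power. The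
  -- two extra powers pay for the summable factor `n⁻²`.
  have h3 : x ^ (p + 2) * y ^ 2 ≤ (2 * c) ^ (p + 2) + (p + 2).factorial := by
    rcases le_or_gt x (2 * c) with h | h
    · have h4 : x ^ (p + 2) * y ^ 2 ≤ (2 * c) ^ (p + 2) * 1 := by
        gcongr
        exact pow_le_one₀ hy h1
      have h5 : (0 : ℝ) ≤ (p + 2).factorial := by positivity
      linarith
    · have h4 : y ^ 2 ≤ Real.exp (-x) := by
        calc y ^ 2 ≤ Real.exp (c - x) ^ 2 := by gcongr
          _ = Real.exp (2 * (c - x)) := by rw [← Real.exp_nat_mul]; norm_num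
          _ ≤ _ := Real.exp_le_exp.2 (by linarith)
      have h5 := Real.pow_div_factorial_le_exp x (by linarith) (p + 2)
      rw [div_le_iff₀ (by positivity)] at h5
      have h6 : x ^ (p + 2) * y ^ 2 ≤ (p + 2).factorial := by
        calc x ^ (p + 2) * y ^ 2 ≤ (Real.exp x * (p + 2).factorial) * Real.exp (-x) := by gcongr
          _ = (Real.exp x * Real.exp (-x)) * (p + 2).factorial := by ring
          _ = _ := by rw [← Real.exp_add]; simp
      have h7 : 0 ≤ (2 * c) ^ (p + 2) := by positivity
      linarith
  calc x ^ q * y ^ 2 * x ^ 2 ≤ x ^ p * y ^ 2 * x ^ 2 := by gcongr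
    _ = x ^ (p + 2) * y ^ 2 := by ring
    _ ≤ _ := h3

theorem timeAvgMoment_lt_top {a : ℤ → ℝ} {A q T : ℝ} (hA : ∀ n, |a n| ≤ A) (hq : 0 < q)
    (hT : 0 < T) : timeAvgMoment a q T < ∞ := by
  have hA0 : 0 ≤ A := (abs_nonneg _).trans (hA 0)
  obtain ⟨p, hp⟩ := exists_nat_ge q
  set Z := ∑' n : ℤ, ((n : ℝ) ^ 2)⁻¹
  have hZ : 0 ≤ Z := tsum_nonneg fun _ => by positivity
  set F : ℝ → ℝ := fun t => (2 * (4 * Real.exp 1 * A * t)) ^ (p + 2) + (p + 2).factorial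
  have hF : ∀ t, 0 ≤ t → 0 ≤ F t := fun t ht => by positivity
  have hint : IntegrableOn (fun t => T⁻¹ * Real.exp (-t / T) * (F t * Z)) (Set.Ioi 0) := by
    have h1 := integrableOn_rpow_mul_exp_neg_mul_rpow (p := 1) (s := ((p + 2 : ℕ) : ℝ)) (b := T⁻¹)
      (by have := Nat.cast_nonneg (α := ℝ) (p + 2); linarith) one_pos (inv_pos.2 hT)
    have h2 : IntegrableOn (fun t : ℝ => Real.exp (-T⁻¹ * t)) (Set.Ioi 0) :=
      integrableOn_exp_mul_Ioi (neg_lt_zero.2 (inv_pos.2 hT)) 0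
    simp only [Real.rpow_natCast, Real.rpow_one] at h1
    refine ((h1.const_mul (T⁻¹ * Z * (8 * Real.exp 1 * A) ^ (p + 2))).add
      (h2.const_mul (T⁻¹ * Z * (p + 2).factorial))).congr (ae_of_all _ fun t => ?_)
    simp only [F, Pi.add_apply]
    rw [show -t / T = -T⁻¹ * t by field_simp,
      show 2 * (4 * Real.exp 1 * A * t) = 8 * Real.exp 1 * A * t by ring, mul_pow _ t]
    ring
  suffices hle : timeAvgMoment a q T ≤
      ∫⁻ t in Set.Ioi 0, ENNReal.ofReal (T⁻¹ * Real.exp (-t / T) * (F t * Z)) from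
    hle.trans_lt hint.lintegral_lt_top
  refine setLIntegral_mono' measurableSet_Ioi fun t ht => ?_
  have ht' : 0 ≤ t := le_of_lt ht
  rw [ENNReal.ofReal_mul (p := T⁻¹ * Real.exp (-t / T)) (by positivity)]
  refine mul_le_mul' le_rfl ?_
  rw [← tsum_mul_left, ENNReal.ofReal_tsum_of_nonneg
    (fun n => mul_nonneg (hF t ht') (by positivity)) (summable_int_sq_inv.mul_left _)]
  refine ENNReal.tsum_le_tsum fun n => ENNReal.ofReal_le_ofReal ?_
  rw [inner_kdelta_left]
  exact moment_term_le hA hq hp ht' n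

/-! ### Jensen: averaged wave against averaged moment. -/

theorem integral_exp_weight {T : ℝ} (hT : 0 < T) :
    ∫ t in Set.Ioi (0 : ℝ), T⁻¹ * Real.exp (-t / T) = 1 := by
  have h := integral_exp_mul_Ioi (neg_lt_zero.2 (inv_pos.2 hT)) 0
  rw [integral_const_mul]
  simp only [show ∀ t : ℝ, -t / T = -T⁻¹ * t from fun t => by field_simp]
  rw [h]
  simp [hT.ne']

/-- The variance `∫ w * (g - I) ^ 2` is nonnegative. -/
theorem sq_integral_mul_le {α : Type*} [MeasurableSpace α] {μ : Measure α} {w g : α → ℝ}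
    (hw0 : ∀ x, 0 ≤ w x) (hw : Integrable w μ) (hw1 : ∫ x, w x ∂μ = 1)
    (hg : Integrable (fun x => w x * g x) μ) (hg2 : Integrable (fun x => w x * g x ^ 2) μ) :
    (∫ x, w x * g x ∂μ) ^ 2 ≤ ∫ x, w x * g x ^ 2 ∂μ := by
  set I := ∫ x, w x * g x ∂μ
  have h : ∫ x, 2 * I * (w x * g x) ∂μ ≤ ∫ x, (w x * g x ^ 2 + I ^ 2 * w x) ∂μ :=
    integral_mono (hg.const_mul _) (hg2.add (hw.const_mul _)) fun x => by
      have := mul_nonneg (hw0 x) (sq_nonneg (g x - I))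
      dsimp only
      linarith
  rw [integral_const_mul, integral_add hg2 (hw.const_mul _), integral_const_mul, hw1] at h
  change 2 * I * I ≤ _ at h
  linarith

theorem sq_norm_avgWave_le {a : ℤ → ℝ} (ha : ∃ C : ℝ, ∀ n, |a n| ≤ C) {T : ℝ} (hT : 0 < T)
    (n : ℤ) :
    ENNReal.ofReal (‖avgWave a T (kdelta 0) n‖ ^ 2) ≤
      ∫⁻ t in Set.Ioi (0 : ℝ), ENNReal.ofReal
        (T⁻¹ * Real.exp (-t / T) * ‖evolution a t (kdelta 0) n‖ ^ 2) := by
  have hcont : Continuous fun t => evolution a t (kdelta 0) n := by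
    have := (innerSL ℂ (kdelta n)).continuous.comp (continuous_evolution a (kdelta 0))
    simpa only [Function.comp_def, innerSL_apply_apply, inner_kdelta_left] using this
  have hb : ∀ t, ‖evolution a t (kdelta 0) n‖ ≤ 1 := fun t => by
    refine (norm_apply_le_norm _ _).trans ?_
    rw [norm_evolution_apply ha, norm_kdelta]
  have hw : IntegrableOn (fun t : ℝ => T⁻¹ * Real.exp (-t / T)) (Set.Ioi 0) := by
    -- A nonintegrable function has integral `0` by convention, whereas this integral is `1`.
    refine not_imp_comm.1 integral_undef ?_
    rw [integral_exp_weight hT]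
    exact one_ne_zero
  have hw0 : ∀ t, 0 ≤ T⁻¹ * Real.exp (-t / T) := fun t => by positivity
  have hg : IntegrableOn (fun t : ℝ => T⁻¹ * Real.exp (-t / T) * ‖evolution a t (kdelta 0) n‖)
      (Set.Ioi 0) := by
    refine hw.mono' (Continuous.aestronglyMeasurable (by fun_prop)) (ae_of_all _ fun t => ?_)
    rw [Real.norm_of_nonneg (by positivity)]
    exact mul_le_of_le_one_right (hw0 t) (hb t)
  have hg2 : IntegrableOn
      (fun t : ℝ => T⁻¹ * Real.exp (-t / T) * ‖evolution a t (kdelta 0) n‖ ^ 2) (Set.Ioi 0) := by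
    refine hw.mono' (Continuous.aestronglyMeasurable (by fun_prop)) (ae_of_all _ fun t => ?_)
    rw [Real.norm_of_nonneg (by positivity)]
    exact mul_le_of_le_one_right (hw0 t) (pow_le_one₀ (norm_nonneg _) (hb t))
  have hval : avgWave a T (kdelta 0) n
      = ∫ t in Set.Ioi (0 : ℝ), (T⁻¹ * Real.exp (-t / T)) • evolution a t (kdelta 0) n := by
    rw [← inner_kdelta_left, ← innerSL_apply_apply, avgWave,
      ← ContinuousLinearMap.integral_comp_comm _ (integrableOn_exp_smul_evolution ha hT _)]
    simp only [innerSL_apply_apply, inner_kdelta_left]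
    rfl
  have hle : ‖avgWave a T (kdelta 0) n‖
      ≤ ∫ t in Set.Ioi (0 : ℝ), T⁻¹ * Real.exp (-t / T) * ‖evolution a t (kdelta 0) n‖ := by
    rw [hval]
    refine (norm_integral_le_integral_norm _).trans (le_of_eq ?_)
    simp only [norm_smul, Real.norm_of_nonneg (hw0 _)]
  rw [← ofReal_integral_eq_lintegral_ofReal hg2 (ae_of_all _ fun t => by positivity)]
  refine ENNReal.ofReal_le_ofReal ((pow_le_pow_left₀ (norm_nonneg _) hle 2).trans ?_)
  exact sq_integral_mul_le hw0 hw (integral_exp_weight hT) hg hg2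

/-- The moment of the time-averaged wave is at most the time-averaged moment. -/
theorem tsum_avgWave_le_timeAvgMoment {a : ℤ → ℝ} (ha : ∃ C : ℝ, ∀ n, |a n| ≤ C) {T : ℝ}
    (hT : 0 < T) (q : ℝ) :
    ∑' n : ℤ, ENNReal.ofReal (|(n : ℝ)| ^ q * ‖avgWave a T (kdelta 0) n‖ ^ 2)
      ≤ timeAvgMoment a q T := by
  have hcont : ∀ n, Continuous fun t => inner ℂ (kdelta n) (evolution a t (kdelta 0)) := fun n =>
    (innerSL ℂ (kdelta n)).continuous.comp (continuous_evolution a (kdelta 0))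
  rw [timeAvgMoment]
  simp only [← ENNReal.tsum_mul_left]
  rw [lintegral_tsum fun n => by
    have := hcont n
    have h1 : Continuous fun t : ℝ => T⁻¹ * Real.exp (-t / T) := by fun_prop
    have h2 : Continuous fun t : ℝ =>
        |(n : ℝ)| ^ q * ‖inner ℂ (kdelta n) (evolution a t (kdelta 0))‖ ^ 2 := by fun_prop
    exact (h1.measurable.ennreal_ofReal.mul h2.measurable.ennreal_ofReal).aemeasurable]
  refine ENNReal.tsum_le_tsum fun n => ?_
  have hn : 0 ≤ |(n : ℝ)| ^ q := by positivity
  rw [ENNReal.ofReal_mul hn]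
  refine (mul_le_mul_right (sq_norm_avgWave_le ha hT n) _).trans ?_
  rw [← lintegral_const_mul' _ _ ENNReal.ofReal_ne_top]
  refine lintegral_mono fun t => le_of_eq ?_
  rw [← ENNReal.ofReal_mul hn, ← ENNReal.ofReal_mul (by positivity), inner_kdelta_left]
  congr 1
  ring

/-! ### Deterministic growth bound. -/

/-- For `n ≠ 0`, `‖u n‖ ≤ n² ‖u n‖² + n⁻²`. This supplies the `ℓ¹` hypothesis of the conservation
law. -/
theorem summable_of_summable_moment {u : ℤ → ℂ} {q : ℝ} (hq : 2 ≤ q)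
    (h : Summable fun n : ℤ => |(n : ℝ)| ^ q * ‖u n‖ ^ 2) : Summable u := by
  refine Summable.of_norm_bounded_eventually (h.add summable_int_sq_inv) ?_
  filter_upwards [(Set.finite_singleton (0 : ℤ)).compl_mem_cofinite] with n hn
  have hn0 : (n : ℝ) ≠ 0 := by exact_mod_cast hn
  have hn1 : 1 ≤ |(n : ℝ)| := by
    have : 1 ≤ |n| := Int.one_le_abs hn
    exact_mod_cast this
  have h2 : (n : ℝ) ^ 2 ≤ |(n : ℝ)| ^ q := by
    rw [← sq_abs, ← Real.rpow_natCast]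
    exact Real.rpow_le_rpow_of_exponent_le hn1 (by simpa using hq)
  have hw : 0 < (n : ℝ) ^ 2 := by positivity
  set w := (n : ℝ) ^ 2
  set x := ‖u n‖
  have h3 : 0 ≤ w⁻¹ * (w * x - 1 / 2) ^ 2 := by positivity
  have h4 : w⁻¹ * (w * x - 1 / 2) ^ 2 = w * x ^ 2 - x + w⁻¹ / 4 := by field_simp; ring
  have h5 : w * x ^ 2 ≤ |(n : ℝ)| ^ q * x ^ 2 := by gcongr
  have h6 : 0 < w⁻¹ := by positivity
  linarith

/-- Uniform ellipticity alone forces polynomial growth of the time-averaged moments. -/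
theorem eventually_rpow_le_timeAvgMoment {a : ℤ → ℝ} {m A q s : ℝ} (hm : 0 < m)
    (hma : ∀ n, m ≤ a n) (hA : ∀ n, |a n| ≤ A) (hq : 2 ≤ q) (hs : s < 2 / 5 * (q - 2)) :
    ∀ᶠ T in atTop, ENNReal.ofReal (T ^ s) ≤ timeAvgMoment a q T := by
  obtain ⟨Z, hZ⟩ := summable_int_sq_inv
  have hZ0 : 0 < Z := by
    have := hZ.tsum_eq ▸ hZ.summable.le_tsum 1 (fun i _ => by positivity)
    simp at this
    linarith
  have hlim1 : Tendsto (fun T : ℝ => T ^ (-(1 / 10 : ℝ))) atTop (nhds 0) :=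
    tendsto_rpow_neg_atTop (by norm_num)
  have hlim2 : Tendsto (fun T : ℝ => T ^ (2 / 5 * (q - 2) - s)) atTop atTop :=
    tendsto_rpow_atTop (by linarith)
  -- Since `2 * k + 1 ≤ 3 * X`, this threshold makes the window carry at most half the mass.
  have hε : 0 < 1 / (6 * (m⁻¹ + 1)) := by positivity
  filter_upwards [hlim1.eventually_le_const hε, hlim2.eventually_ge_atTop (2 ^ (q - 2) * (16 * Z)),
    eventually_ge_atTop 1] with T hT1 hT2 hT
  have hT0 : 0 < T := by linarith
  -- The window is shorter than `√T` by the factor `T^(-1/10)`, which absorbs the constant in the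
  -- sup bound.
  set X := T ^ (2 / 5 : ℝ) with hX
  have hX1 : 1 ≤ X := Real.one_le_rpow hT (by norm_num)
  set k := ⌊X⌋₊
  have hk : 0 < k := Nat.floor_pos.2 hX1
  have hkX : (k : ℝ) ≤ X := Nat.floor_le (by linarith)
  have hXk : X / 2 ≤ k := by
    have h1 := Nat.lt_floor_add_one X
    have h2 : (1 : ℝ) ≤ k := by exact_mod_cast hk
    change X < k + 1 at h1
    linarith
  have hfin := timeAvgMoment_lt_top hA (by linarith : 0 < q) hT0
  have hle := tsum_avgWave_le_timeAvgMoment ⟨A, hA⟩ hT0 q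
  set u := avgWave a T (kdelta 0)
  have hS : Summable fun n : ℤ => |(n : ℝ)| ^ q * ‖u n‖ ^ 2 := by
    have := ENNReal.summable_toReal (hle.trans_lt hfin).ne
    refine this.congr fun n => ENNReal.toReal_ofReal (by positivity)
  have hu : Summable u := summable_of_summable_moment hq hS
  have heq := fun n => avgWave_resolvent_eq_apply ⟨A, hA⟩ hT0 n
  have hkc : (2 * k + 1) * ((m⁻¹ + 1) / √T) ≤ 1 / 2 := by
    have h1 : X / √T = T ^ (-(1 / 10 : ℝ)) := by
      rw [hX, Real.sqrt_eq_rpow, ← Real.rpow_sub hT0]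
      norm_num
    have h2 : (2 * k + 1 : ℝ) ≤ 3 * X := by linarith
    calc (2 * k + 1) * ((m⁻¹ + 1) / √T) ≤ 3 * X * ((m⁻¹ + 1) / √T) := by gcongr
      _ = 3 * (m⁻¹ + 1) * (X / √T) := by ring
      _ ≤ 3 * (m⁻¹ + 1) * (1 / (6 * (m⁻¹ + 1))) := by rw [h1]; gcongr
      _ = 1 / 2 := by field_simp; norm_num
  have hmom := moment_lower_bound hk hq hu (tsum_eq_one_of_resolvent_eq hA hu heq)
    (norm_le_of_resolvent_eq hm hma hA hT0 hu heq) hkc hZ hS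
  rw [← ENNReal.ofReal_tsum_of_nonneg (fun n => by positivity) hS] at hle
  refine (ENNReal.ofReal_le_ofReal (le_trans ?_ hmom)).trans hle
  rw [le_div_iff₀ (by positivity)]
  have h3 : (X / 2) ^ (q - 2) ≤ (k : ℝ) ^ (q - 2) :=
    Real.rpow_le_rpow (by positivity) hXk (by linarith)
  refine le_trans ?_ h3
  rw [Real.div_rpow (by positivity) (by norm_num), hX, ← Real.rpow_mul hT0.le,
    le_div_iff₀ (by positivity)]
  calc T ^ s * (16 * Z) * 2 ^ (q - 2) = T ^ s * (2 ^ (q - 2) * (16 * Z)) := by ring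
    _ ≤ T ^ s * T ^ (2 / 5 * (q - 2) - s) := by gcongr
    _ = _ := by rw [← Real.rpow_add hT0]; congr 1; ring

/-! ### Random coefficients and conclusion. -/

theorem ae_mem_Icc_of_law {Ω : Type*} [MeasurableSpace Ω] {P : Measure Ω}
    {P₀ : Measure ℝ} {a : ℤ → Ω → ℝ} (ha_meas : ∀ n, Measurable (a n))
    (ha_law : ∀ n, P.map (a n) = P₀) (hb : BddBelow P₀.support) (h_bdd : BddAbove P₀.support) :
    ∀ᵐ ω ∂P, ∀ n, a n ω ∈ Set.Icc (sInf P₀.support) (sSup P₀.support) := by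
  refine ae_all_iff.2 fun n => ?_
  have h : ∀ᵐ x ∂(P.map (a n)), x ∈ P₀.support := by
    rw [ha_law n]
    exact Measure.support_mem_ae
  filter_upwards [ae_of_ae_map (ha_meas n).aemeasurable h] with ω hω
  exact ⟨csInf_le hb hω, le_csSup h_bdd hω⟩

theorem theorem1p2 {Ω : Type*} [MeasurableSpace Ω] (P : Measure Ω) [IsProbabilityMeasure P]
    (P₀ : Measure ℝ) [IsProbabilityMeasure P₀]
    (a : ℤ → Ω → ℝ) (ha_meas : ∀ n, Measurable (a n))
    (ha_indep : iIndepFun a P) (ha_law : ∀ n, P.map (a n) = P₀)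
    (h_pos : 0 < sInf P₀.support) (h_nontriv : sInf P₀.support < sSup P₀.support)
    (h_bdd : BddAbove P₀.support)
    (q : ℝ) (hq : 11 / 2 ≤ q) :
    ∀ᵐ ω ∂P,
      (∀ T : ℝ, 0 < T → timeAvgMoment (fun n => a n ω) q T < ∞) ∧
      ((2 / 5 - 11 / (5 * q) : ℝ) : EReal) ≤
        liminf (fun T : ℝ =>
          ENNReal.log (timeAvgMoment (fun n => a n ω) q T) / ((q * Real.log T : ℝ) : EReal))
          atTop := by
  have hb : BddBelow P₀.support := by
    -- The infimum of a set unbounded below is `0` by convention, contradicting positivity.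
    by_contra h
    exact h_pos.ne' (Real.sInf_of_not_bddBelow h)
  filter_upwards [ae_mem_Icc_of_law ha_meas ha_law hb h_bdd] with ω hω
  have hA : ∀ n, |a n ω| ≤ sSup P₀.support := fun n => by
    rw [abs_of_pos (h_pos.trans_le (hω n).1)]
    exact (hω n).2
  have hq0 : 0 < q := by linarith
  refine ⟨fun T hT => timeAvgMoment_lt_top hA hq0 hT, ?_⟩
  -- Here `s = 2/5 * q - 11/5`, strictly below `2/5 * q - 4/5`.
  have hev := eventually_rpow_le_timeAvgMoment (q := q) (s := (2 / 5 - 11 / (5 * q)) * q) h_pos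
    (fun n => (hω n).1) hA (by linarith) (by field_simp; linarith)
  refine le_liminf_of_le (by isBoundedDefault) ?_
  filter_upwards [hev, eventually_gt_atTop 1] with T hT hT1
  have hlog : 0 < Real.log T := Real.log_pos hT1
  have hTs : 0 < T ^ ((2 / 5 - 11 / (5 * q)) * q) := Real.rpow_pos_of_pos (by linarith) _
  rw [EReal.le_div_iff_mul_le (by exact_mod_cast mul_pos hq0 hlog) (EReal.coe_ne_top _),
    ← EReal.coe_mul]
  refine le_trans (le_of_eq ?_) (ENNReal.log_le_log hT)
  rw [ENNReal.log_ofReal, if_neg hTs.not_ge, Real.log_rpow (by linarith), mul_assoc]
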